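/- For finite sets $A, B \subset \mathbb{R}$ write $A-B=\{a-b\}$, $xA=\{xa: a\in A\}$, $x+A=\{x+a : a\in A\}$, and $B^{-1}=\{b^{-1} : b\in B,\ b\neq 0\}$. For a nonempty finite $A\subset\mathbb{R}$ put $$d_*(A)=\min_{t>0}\ \min_{Q,R}\ \frac{|Q|^2|R|^2}{|A|\,t^3},\qquad d_+(A)=\min_{t>0}\ \min_{Q,R}\ \frac{|Q|^2|R|^2}{|A|\,t^3},$$ where $t$ is real and the inner minimum is over all nonempty finite sets $Q,R\subset\mathbb{R}\setminus\{0\}$ with $\max\{|Q|,|R|\}\ge|A|$ such that, for every $x\in A$, $|Q\cap xR^{-1}|\ge t$ (in the definition of $d_*$, where $0\notin A$), respectively $|Q\cap(x-R)|\ge t$ (in the definition of $d_+$). For $D>0$, a finite set $A\subset\mathbb{R}$ is of additive Szemerédi–Trotter type with parameter $D$ if $$|\{s\in A-B : |A\cap(B+s)|\ge\tau\}|\le \frac{D|A||B|^2}{\tau^3}$$ for every finite $B\subset\mathbb{R}$ and every real $\tau\ge1$, and of multiplicative Szemerédi–Trotter type with parameter $D$ if for all such $B$ and $\tau$ $$|\{s\in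 AB^{-1} : |A\cap sB|\ge\tau\}|\le \frac{D|A||B|^2}{\tau^3}.$$ **Lemma 19.** There are absolute constants $C,c>0$ such that the following holds for all finite sets $A,P\subset\mathbb{R}$ with $|A|\ge2$. (i) Put $\sigma_*=\sum_{x\in P}|A\cap xA|$. If $0\notin A$ and $\sigma_*>0$, then there is $A'\subseteq A$ such that $A'$ is of additive Szemerédi–Trotter type with parameter $C\,d_*(A')$, $$d_*(A')\le C(\log|A|)^c\,\frac{|P|^2|A|^2|A'|^2}{\sigma_*^3}\qquad\text{and}\qquad \frac{\sigma_*}{|P|}\le C(\log|A|)^c\,|A'|.$$ (ii) Put $\sigma_+=\sum_{x\in P}|A\cap(x+A)|$. If $\sigma_+>0$, then there is $A''\subseteq A$ such that $A''$ is of multiplicative Szemerédi–Trotter type with parameter $C\,d_+(A'')$, $$d_+(A'')\le C(\log|A|)^c\,\frac{|P|^2|A|^2|A''|^2}{\sigma_+^3}\qquad\text{and}\qquad \frac{\sigma_+}{|P|}\le C(\log|A|)^c\,|A''|.$$ -/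

import Mathlib

open scoped Pointwise

noncomputable section

namespace SumProduct

/-- `Sym_t^×(Q, R) = {x : |Q ∩ x R⁻¹| ≥ t}`. -/
def symMul (t : ℝ) (Q R : Finset ℝ) : Set ℝ :=
  {x | t ≤ ((Q ∩ x • R⁻¹).card : ℝ)}

/-- `Sym_t^+(Q, R) = {x : |Q ∩ (x - R)| ≥ t}`. -/
def symAdd (t : ℝ) (Q R : Finset ℝ) : Set ℝ :=
  {x | t ≤ ((Q ∩ ({x} - R)).card : ℝ)}

/-- The set of all quotients `|Q|² |R|² / (|A| t³)`, where `t > 0` is real and `Q`, `R` are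
nonempty finite sets of nonzero reals with `A ⊆ Sym_t^×(Q, R)` and `max (|Q|, |R|) ≥ |A|`. -/
def dMulValues (A : Finset ℝ) : Set ℝ :=
  {v | ∃ (t : ℝ) (Q R : Finset ℝ), 0 < t ∧ Q.Nonempty ∧ R.Nonempty ∧ 0 ∉ Q ∧ 0 ∉ R ∧
    (A : Set ℝ) ⊆ symMul t Q R ∧ A.card ≤ max Q.card R.card ∧
    v = (Q.card : ℝ) ^ 2 * (R.card : ℝ) ^ 2 / ((A.card : ℝ) * t ^ 3)}

/-- The set of all quotients `|Q|² |R|² / (|A| t³)`, where `t > 0` is real and `Q`, `R` are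
nonempty finite sets of nonzero reals with `A ⊆ Sym_t^+(Q, R)` and `max (|Q|, |R|) ≥ |A|`. -/
def dAddValues (A : Finset ℝ) : Set ℝ :=
  {v | ∃ (t : ℝ) (Q R : Finset ℝ), 0 < t ∧ Q.Nonempty ∧ R.Nonempty ∧ 0 ∉ Q ∧ 0 ∉ R ∧
    (A : Set ℝ) ⊆ symAdd t Q R ∧ A.card ≤ max Q.card R.card ∧
    v = (Q.card : ℝ) ^ 2 * (R.card : ℝ) ^ 2 / ((A.card : ℝ) * t ^ 3)}

/-- `d_*(A)`, for a nonempty finite set `A` of nonzero reals (otherwise a junk value: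
there are no admissible `Q`, `R`, `t` if `0 ∈ A`). -/
def dMul (A : Finset ℝ) : ℝ := sInf (dMulValues A)

/-- `d_+(A)`, for a nonempty finite set `A` of reals. -/
def dAdd (A : Finset ℝ) : ℝ := sInf (dAddValues A)

/-- `A` is of (additive) Szemerédi–Trotter type with parameter `D > 0`: for every finite `B ⊂ ℝ`
and every real `τ ≥ 1`, `|{s ∈ A - B : |A ∩ (B + s)| ≥ τ}| ≤ D |A| |B|² / τ³`. -/
def IsSzTAdd (A : Finset ℝ) (D : ℝ) : Prop :=
  0 < D ∧ ∀ (B : Finset ℝ) (τ : ℝ), 1 ≤ τ →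
    (((A - B).filter fun s => τ ≤ ((A ∩ (s +ᵥ B)).card : ℝ)).card : ℝ) ≤
      D * (A.card : ℝ) * (B.card : ℝ) ^ 2 / τ ^ 3

/-- `A` is of multiplicative Szemerédi–Trotter type with parameter `D > 0`: for every finite
`B ⊂ ℝ` and every real `τ ≥ 1`, `|{s ∈ A B⁻¹ : |A ∩ s B| ≥ τ}| ≤ D |A| |B|² / τ³`. Here `B⁻¹` is
the set of the inverses of the nonzero elements of `B`. -/
def IsSzTMul (A : Finset ℝ) (D : ℝ) : Prop :=
  0 < D ∧ ∀ (B : Finset ℝ) (τ : ℝ), 1 ≤ τ →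
    (((A * (B.erase 0)⁻¹).filter fun s => τ ≤ ((A ∩ s • B).card : ℝ)).card : ℝ) ≤
      D * (A.card : ℝ) * (B.card : ℝ) ^ 2 / τ ^ 3

/-- `σ_* = ∑_{x ∈ P} |A ∩ xA|`. -/
def sigmaMul (A P : Finset ℝ) : ℕ := ∑ x ∈ P, (A ∩ x • A).card

/-- `σ_+ = ∑_{x ∈ P} |A ∩ (x + A)|`. -/
def sigmaAdd (A P : Finset ℝ) : ℕ := ∑ x ∈ P, (A ∩ (x +ᵥ A)).card

end SumProduct

end

/-! In the first case write `σ_*` as the sum over `a ∈ A` of the number `r(a)` of solutions of `x b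
= a` with `x ∈ P \ {0}`, `b ∈ A`. By pigeonhole some level `t` satisfies `σ_* ≤ 3 log|A| · t |A'|`,
where `A' = {a ∈ A : r(a) ≥ t}`. Then `Q = P \ {0}`, `R = A` and `t` are admissible for `A'`.
Replacing `t` by this lower bound turns their quotient into the bound for `d_*(A')`, and `t ≤ |P|`
gives the bound for `σ_*/|P|`. The second case is the same with sums for products
(`exists_popular_level`, `popular_level_bounds`).

The Szemerédi–Trotter type of `A'` holds for any admissible `Q, R, t`. If each `s ∈ S` has `τ`
solutions of `s + b = a`, substituting `a = q r` yields `|S| τ t` incidences between the grid `Q ×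
B` and the lines `y = r x - s` (`rich_translates_bound`). For dilates, `s b = q + r` puts `(b, q)`
on `y = s x - r` (`rich_dilates_bound`). The incidence bound needed is only for grids, where cutting
into rectangular cells is elementary (`card_gridIncidences_dichotomy`). -/

namespace SumProduct

/-! ### Incidences between a grid and lines -/

/-- A finite set of reals can be cut into consecutive blocks of at most `w` elements each. -/
theorem exists_monotone_blocks (X : Finset ℝ) {w : ℕ} (hw : 0 < w) :
    ∃ f : ℝ → ℕ, Monotone f ∧ (∀ x, f x ≤ X.card / w) ∧
      ∀ j, (X.filter fun x => f x = j).card ≤ w := by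
  classical
  have hmono : Monotone fun x : ℝ => (X.filter (· < x)).card := by
    intro x y hxy
    refine Finset.card_le_card fun z hz => ?_
    simp only [Finset.mem_filter] at hz ⊢
    exact ⟨hz.1, hz.2.trans_le hxy⟩
  have hstrict : ∀ x ∈ X, ∀ y, x < y → (X.filter (· < x)).card < (X.filter (· < y)).card := by
    intro x hx y hxy
    refine Finset.card_lt_card ⟨fun z hz => ?_, fun h => ?_⟩
    · simp only [Finset.mem_filter] at hz ⊢
      exact ⟨hz.1, hz.2.trans hxy⟩
    · have := h (Finset.mem_filter.2 ⟨hx, hxy⟩)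
      simp at this
  -- The block index is the rank in `X` divided by `w`; by `hstrict` the rank is injective on `X`.
  refine ⟨fun x => (X.filter (· < x)).card / w, fun x y h => Nat.div_le_div_right (hmono h),
    fun x => Nat.div_le_div_right (Finset.card_filter_le _ _), fun j => ?_⟩
  calc (X.filter fun x => (X.filter (· < x)).card / w = j).card
      ≤ (Finset.Ico (w * j) (w * j + w)).card := by
        refine Finset.card_le_card_of_injOn (fun x => (X.filter (· < x)).card) ?_ ?_
        · intro x hx
          have hx : _ / w = j := (Finset.mem_filter.1 hx).2
          have h1 := Nat.div_add_mod (X.filter (· < x)).card w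
          have h2 := Nat.mod_lt (X.filter (· < x)).card hw
          rw [hx] at h1
          simp only [Finset.coe_Ico, Set.mem_Ico]
          omega
        · intro x hx y hy hxy
          have hxX := (Finset.mem_filter.1 hx).1
          have hyX := (Finset.mem_filter.1 hy).1
          rcases lt_trichotomy x y with h | h | h
          · exact absurd hxy (hstrict x hxX y h).ne
          · exact h
          · exact absurd hxy (hstrict y hyX x h).ne'
    _ = w := by simp

theorem card_filter_same_block_le {f : ℝ → ℕ} {X : Finset ℝ} {w : ℕ}
    (hf : ∀ j, (X.filter fun x => f x = j).card ≤ w) :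
    ((X ×ˢ X).filter fun p => f p.1 = f p.2).card ≤ X.card * w := by
  classical
  rw [Finset.card_filter, Finset.sum_product, ← smul_eq_mul]
  refine Finset.sum_le_card_nsmul _ _ _ fun x _ => ?_
  rw [← Finset.card_filter]
  simpa only [eq_comm] using hf (f x)

/-- A set is at most as large as its image plus the number of collisions. -/
theorem card_le_card_image_add_card_collisions {α β : Type*} [DecidableEq α] [DecidableEq β]
    (T : Finset α) (c : α → β) :
    T.card ≤ (T.image c).card + (T.offDiag.filter fun p => c p.1 = c p.2).card := by
  induction T using Finset.induction_on with
  | empty => simp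
  | insert a T ha ih =>
    rw [Finset.card_insert_of_notMem ha, Finset.image_insert]
    have hsub : T.offDiag.filter (fun p => c p.1 = c p.2) ⊆
        (insert a T).offDiag.filter (fun p => c p.1 = c p.2) :=
      Finset.filter_subset_filter _ (Finset.offDiag_mono (Finset.subset_insert _ _))
    by_cases h : c a ∈ T.image c
    · rw [Finset.insert_eq_of_mem h]
      obtain ⟨b, hb, hba⟩ := Finset.mem_image.1 h
      have hlt : (T.offDiag.filter fun p => c p.1 = c p.2).card <
          ((insert a T).offDiag.filter fun p => c p.1 = c p.2).card := by
        refine Finset.card_lt_card ⟨hsub, fun h' => ?_⟩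
        have hab : b ≠ a := fun e => ha (e ▸ hb)
        have : (b, a) ∈ (insert a T).offDiag.filter fun p => c p.1 = c p.2 := by
          simp [hb, hba, hab]
        have := h' this
        simp [ha] at this
      omega
    · rw [Finset.card_insert_of_notMem h]
      have := Finset.card_le_card hsub
      omega

/-- The incidences between the points of `X × Y` and the lines `y = m x + k` with `m ∈ M`,
`k ∈ K`, as triples `(x, (m, k))`. -/
noncomputable def gridIncidences (X Y M K : Finset ℝ) : Finset (ℝ × (ℝ × ℝ)) :=
  (X ×ˢ (M ×ˢ K)).filter fun p => p.2.1 * p.1 + p.2.2 ∈ Y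

theorem card_gridIncidences_eq_sum (X Y M K : Finset ℝ) :
    (gridIncidences X Y M K).card =
      ∑ l ∈ M ×ˢ K, (X.filter fun x => l.1 * x + l.2 ∈ Y).card := by
  rw [gridIncidences, Finset.card_filter, Finset.sum_product_right]
  simp only [Finset.card_filter]

theorem card_gridIncidences_le_left (X Y M K : Finset ℝ) :
    (gridIncidences X Y M K).card ≤ M.card * K.card * X.card := by
  rw [card_gridIncidences_eq_sum, ← Finset.card_product, ← smul_eq_mul]
  exact Finset.sum_le_card_nsmul _ _ _ fun l _ => Finset.card_filter_le _ _

/-- A line of nonzero slope meets each horizontal line once. With the bound by columns this replaces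
the usual term linear in the number of points. -/
theorem card_gridIncidences_le_right (X Y : Finset ℝ) {M : Finset ℝ} (K : Finset ℝ)
    (hM : 0 ∉ M) : (gridIncidences X Y M K).card ≤ M.card * K.card * Y.card := by
  rw [card_gridIncidences_eq_sum, ← Finset.card_product, ← smul_eq_mul]
  refine Finset.sum_le_card_nsmul _ _ _ fun l hl => ?_
  have hl0 : l.1 ≠ 0 := fun h => hM (h ▸ (Finset.mem_product.1 hl).1)
  refine Finset.card_le_card_of_injOn (fun x => l.1 * x + l.2)
    (fun x hx => (Finset.mem_filter.1 hx).2) fun x _ y _ hxy => ?_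
  exact mul_left_cancel₀ hl0 (add_right_cancel hxy)

/-- A line that is not horizontal meets few cells of a grid. -/
theorem card_image_cells_le {f g : ℝ → ℕ} (hf : Monotone f) (hg : Monotone g) {r s : ℕ}
    (hr : ∀ x, f x ≤ r) (hs : ∀ x, g x ≤ s) (T : Finset ℝ) (m k : ℝ) :
    (T.image fun x => (f x, g (m * x + k))).card ≤ r + s + 1 := by
  classical
  rcases le_total 0 m with hm | hm
  -- Along a line with `m ≥ 0` both cell coordinates are weakly increasing, so their sum separates
  -- the cells.
  · calc _ ≤ (Finset.range (r + s + 1)).card := by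
          refine Finset.card_le_card_of_injOn (fun c => c.1 + c.2) ?_ ?_
          · intro c hc
            obtain ⟨x, -, rfl⟩ := Finset.mem_image.1 hc
            have := hr x
            have := hs (m * x + k)
            simp only [Finset.coe_range, Set.mem_Iio]
            omega
          · intro c hc d hd h
            obtain ⟨x, -, rfl⟩ := Finset.mem_image.1 hc
            obtain ⟨y, -, rfl⟩ := Finset.mem_image.1 hd
            simp only [Prod.mk.injEq] at h ⊢
            rcases le_total x y with hxy | hxy
            · have := hf hxy
              have := hg (show m * x + k ≤ m * y + k by gcongr)
              omega
            · have := hf hxy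
              have := hg (show m * y + k ≤ m * x + k by gcongr)
              omega
      _ = _ := by simp
  · calc _ ≤ (Finset.range (r + s + 1)).card := by
          -- For `m ≤ 0` the second coordinate decreases and is reversed first; `hs` prevents
          -- truncation in `s - c.2`.
          refine Finset.card_le_card_of_injOn (fun c => c.1 + (s - c.2)) ?_ ?_
          · intro c hc
            obtain ⟨x, -, rfl⟩ := Finset.mem_image.1 hc
            have := hr x
            simp only [Finset.coe_range, Set.mem_Iio]
            omega
          · intro c hc d hd h
            obtain ⟨x, -, rfl⟩ := Finset.mem_image.1 hc
            obtain ⟨y, -, rfl⟩ := Finset.mem_image.1 hd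
            simp only [Prod.mk.injEq] at h ⊢
            have := hs (m * x + k)
            have := hs (m * y + k)
            rcases le_total x y with hxy | hxy
            · have := hf hxy
              have := hg (show m * y + k ≤ m * x + k by
                have := mul_le_mul_of_nonpos_left hxy hm; linarith)
              omega
            · have := hf hxy
              have := hg (show m * x + k ≤ m * y + k by
                have := mul_le_mul_of_nonpos_left hxy hm; linarith)
              omega
      _ = _ := by simp

/-- The incidence bound obtained from cutting the grid into cells of size `u × v`. -/
theorem card_gridIncidences_le_cells (X Y M K : Finset ℝ) {u v : ℕ} (hu : 0 < u) (hv : 0 < v) :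
    (gridIncidences X Y M K).card ≤
      M.card * K.card * (X.card / u + Y.card / v + 1) + X.card * u * (Y.card * v) := by
  classical
  obtain ⟨f, hf, hfr, hfw⟩ := exists_monotone_blocks X hu
  obtain ⟨g, hg, hgs, hgw⟩ := exists_monotone_blocks Y hv
  set T : ℝ × ℝ → Finset ℝ := fun l => X.filter fun x => l.1 * x + l.2 ∈ Y with hT
  set E : ℝ × ℝ → Finset (ℝ × ℝ) := fun l => (T l).offDiag.filter fun p =>
    (f p.1, g (l.1 * p.1 + l.2)) = (f p.2, g (l.1 * p.2 + l.2)) with hE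
  have h1 : ∑ l ∈ M ×ˢ K, (T l).card ≤
      ∑ l ∈ M ×ˢ K, ((X.card / u + Y.card / v + 1) + (E l).card) := by
    refine Finset.sum_le_sum fun l _ => ?_
    refine (card_le_card_image_add_card_collisions (T l)
      fun x => (f x, g (l.1 * x + l.2))).trans ?_
    exact Nat.add_le_add_right (card_image_cells_le hf hg hfr hgs _ _ _) _
  -- Two distinct points determine their line, so each ordered pair of points in a common cell is
  -- counted for at most one line.
  have h2 : ∑ l ∈ M ×ˢ K, (E l).card ≤ X.card * u * (Y.card * v) := by
    rw [← Finset.card_sigma]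
    refine le_trans ?_ (Nat.mul_le_mul (card_filter_same_block_le hfw)
      (card_filter_same_block_le hgw))
    rw [← Finset.card_product]
    refine Finset.card_le_card_of_injOn
      (fun p => (p.2, (p.1.1 * p.2.1 + p.1.2, p.1.1 * p.2.2 + p.1.2))) ?_ ?_
    · rintro ⟨l, p⟩ hp
      simp only [hE, hT, Finset.coe_sigma, Set.mem_sigma_iff, Finset.mem_coe, Finset.mem_filter,
        Finset.mem_offDiag, Prod.mk.injEq] at hp
      simp only [Finset.coe_product, Set.mem_prod, Finset.mem_coe, Finset.mem_filter,
        Finset.mem_product]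
      tauto
    · rintro ⟨⟨m, k⟩, ⟨x, y⟩⟩ hp ⟨⟨m', k'⟩, ⟨x', y'⟩⟩ - h
      simp only [hE, Finset.coe_sigma, Set.mem_sigma_iff, Finset.mem_coe, Finset.mem_filter,
        Finset.mem_offDiag] at hp
      have hne : x ≠ y := hp.2.1.2.2
      simp only [Prod.mk.injEq] at h
      obtain ⟨⟨rfl, rfl⟩, ha, hb⟩ := h
      have hm : m = m' := by
        refine mul_right_cancel₀ (sub_ne_zero.2 hne) ?_
        linarith
      subst hm
      have hk : k = k' := by linarith
      subst hk
      rfl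
  rw [card_gridIncidences_eq_sum]
  rw [Finset.sum_add_distrib, Finset.sum_const, Finset.card_product, smul_eq_mul] at h1
  exact h1.trans (Nat.add_le_add_left h2 _)

/-- The Szemerédi–Trotter bound for the points of a grid. -/
theorem card_gridIncidences_dichotomy (X Y : Finset ℝ) {M : Finset ℝ} (K : Finset ℝ)
    (hM : 0 ∉ M) :
    ((gridIncidences X Y M K).card : ℝ) ^ 3 ≤
        343 * ((X.card : ℝ) * Y.card) ^ 2 * ((M.card : ℝ) * K.card) ^ 2 ∨
      ((gridIncidences X Y M K).card : ℝ) ≤ 4 * ((M.card : ℝ) * K.card) := by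
  have hl : ((gridIncidences X Y M K).card : ℝ) ≤ (M.card : ℝ) * K.card * X.card := by
    exact_mod_cast card_gridIncidences_le_left X Y M K
  have hr : ((gridIncidences X Y M K).card : ℝ) ≤ (M.card : ℝ) * K.card * Y.card := by
    exact_mod_cast card_gridIncidences_le_right X Y K hM
  have hone : 0 < (X.card : ℝ) → 0 < (Y.card : ℝ) → ((gridIncidences X Y M K).card : ℝ) ≤
      3 * ((M.card : ℝ) * K.card) + ((X.card : ℝ) * Y.card) ^ 2 := by
    intro hx hy
    have h := card_gridIncidences_le_cells X Y M K (u := X.card) (v := Y.card)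
      (by exact_mod_cast hx) (by exact_mod_cast hy)
    rw [Nat.div_self (by exact_mod_cast hx), Nat.div_self (by exact_mod_cast hy)] at h
    have h : ((gridIncidences X Y M K).card : ℝ) ≤ (M.card : ℝ) * K.card * (1 + 1 + 1) +
        X.card * X.card * (Y.card * Y.card) := by exact_mod_cast h
    linarith
  have hc : ∀ u v : ℕ, 0 < u → 0 < v → ((gridIncidences X Y M K).card : ℝ) ≤
      (M.card : ℝ) * K.card * ((X.card : ℝ) / u + (Y.card : ℝ) / v + 1) +
        X.card * u * (Y.card * v) := by
    intro u v hu hv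
    have h : ((gridIncidences X Y M K).card : ℝ) ≤
      (M.card : ℝ) * K.card * (((X.card / u : ℕ) : ℝ) + ((Y.card / v : ℕ) : ℝ) + 1) +
        X.card * u * (Y.card * v) := by
      exact_mod_cast card_gridIncidences_le_cells X Y M K hu hv
    refine h.trans ?_
    gcongr <;> exact Nat.cast_div_le
  have hI : (0 : ℝ) ≤ (gridIncidences X Y M K).card := Nat.cast_nonneg _
  have hx : (0 : ℝ) ≤ X.card := Nat.cast_nonneg _
  have hy : (0 : ℝ) ≤ Y.card := Nat.cast_nonneg _
  have hL : (0 : ℝ) ≤ (M.card : ℝ) * K.card := by positivity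
  generalize ((gridIncidences X Y M K).card : ℝ) = I at *
  generalize (X.card : ℝ) = x at *
  generalize (Y.card : ℝ) = y at *
  generalize (M.card : ℝ) * K.card = L at *
  -- With few lines the trivial bounds `I ≤ L y` and `I ≤ L x` already suffice.
  rcases le_or_gt (L * y) (x ^ 2) with h1 | h1
  · left
    calc I ^ 3 ≤ (L * y) ^ 3 := by gcongr
      _ = (L * y) ^ 2 * (L * y) := by ring
      _ ≤ (L * y) ^ 2 * x ^ 2 := by gcongr
      _ = 1 * (x * y) ^ 2 * L ^ 2 := by ring
      _ ≤ 343 * (x * y) ^ 2 * L ^ 2 := by gcongr; norm_num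
  rcases le_or_gt (L * x) (y ^ 2) with h2 | h2
  · left
    calc I ^ 3 ≤ (L * x) ^ 3 := by gcongr
      _ = (L * x) ^ 2 * (L * x) := by ring
      _ ≤ (L * x) ^ 2 * y ^ 2 := by gcongr
      _ = 1 * (x * y) ^ 2 * L ^ 2 := by ring
      _ ≤ 343 * (x * y) ^ 2 * L ^ 2 := by gcongr; norm_num
  have hL0 : 0 < L := by
    rcases hL.eq_or_lt with h | h
    · rw [← h] at h1; nlinarith [sq_nonneg x]
    · exact h
  have hx0 : 0 < x := by
    rcases hx.eq_or_lt with h | h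
    · rw [← h] at h2; nlinarith [sq_nonneg y]
    · exact h
  have hy0 : 0 < y := by
    rcases hy.eq_or_lt with h | h
    · rw [← h] at h1; nlinarith [sq_nonneg x]
    · exact h
  -- With very many lines, blocks as long as the sides are enough, and the term linear in `L`
  -- dominates.
  rcases le_or_gt ((x * y) ^ 2) L with h3 | h3
  · right
    linarith [hone hx0 hy0]
  left
  -- About `ρ` blocks per side balance the cell count `L ρ` against the collisions `(x y)² / ρ²`.
  -- The excluded regimes say exactly that `1 < ρ < min(x, y)`: the first inequality absorbs the
  -- extra cell, the second makes rounding block lengths up cost at most a factor 2.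
  obtain ⟨ρ, hρ, hρ3⟩ : ∃ ρ : ℝ, 0 < ρ ∧ ρ ^ 3 * L = (x * y) ^ 2 := by
    refine ⟨((x * y) ^ 2 / L) ^ ((1 : ℝ) / 3), by positivity, ?_⟩
    rw [← Real.rpow_natCast, ← Real.rpow_mul (by positivity)]
    norm_num
    field_simp
  have hρ1 : 1 < ρ := by
    by_contra! h
    have : ρ ^ 3 ≤ 1 := pow_le_one₀ hρ.le h
    nlinarith
  have hρx : ρ < x := by
    refine lt_of_pow_lt_pow_left₀ 3 hx ?_
    refine lt_of_mul_lt_mul_right ?_ hL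
    rw [hρ3]
    nlinarith [mul_lt_mul_of_pos_left h2 (pow_pos hx0 2)]
  have hρy : ρ < y := by
    refine lt_of_pow_lt_pow_left₀ 3 hy ?_
    refine lt_of_mul_lt_mul_right ?_ hL
    rw [hρ3]
    nlinarith [mul_lt_mul_of_pos_left h1 (pow_pos hy0 2)]
  have hwid : ∀ z : ℝ, ρ < z → ∃ u : ℕ, 0 < u ∧ z / u ≤ ρ ∧ (u : ℝ) ≤ 2 * (z / ρ) := by
    intro z hz
    have hzρ : 1 < z / ρ := (one_lt_div hρ).2 hz
    have hu : 0 < ⌈z / ρ⌉₊ := Nat.ceil_pos.2 (by linarith)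
    refine ⟨⌈z / ρ⌉₊, hu, ?_, ?_⟩
    · rw [div_le_comm₀ (by exact_mod_cast hu) hρ]
      exact Nat.le_ceil _
    · have := Nat.ceil_lt_add_one (show 0 ≤ z / ρ by linarith)
      linarith
  obtain ⟨u, hu, hux, hu2⟩ := hwid x hρx
  obtain ⟨v, hv, hvy, hv2⟩ := hwid y hρy
  have hfin : I ≤ 7 * (ρ * L) := by
    calc I ≤ L * (x / u + y / v + 1) + x * u * (y * v) := hc u v hu hv
      _ ≤ L * (ρ + ρ + ρ) + x * (2 * (x / ρ)) * (y * (2 * (y / ρ))) := by gcongr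
      _ = 3 * (ρ * L) + 4 * ((x * y) ^ 2 / ρ ^ 2) := by field_simp; ring
      _ = 7 * (ρ * L) := by rw [← hρ3]; field_simp; ring
  calc I ^ 3 ≤ (7 * (ρ * L)) ^ 3 := by gcongr
    _ = 343 * (ρ ^ 3 * L) * L ^ 2 := by ring
    _ = _ := by rw [hρ3]

/-! ### Rich translates and dilates -/

/-- In the main regime `S²` cancels. When the line term dominates, `τ t ≤ 4 R`, and the rest comes
from `S τ ≤ A B` with `A, t ≤ Q`; this is where `|A| ≤ max(|Q|, |R|)` enters. -/
theorem rich_card_bound {S τ t A B Q R I : ℝ} (hS : 0 ≤ S) (hτ : 0 < τ) (ht : 0 < t)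
    (hA : 0 ≤ A) (hQ : 0 ≤ Q) (hB : 1 ≤ B) (hAQ : A ≤ Q) (htQ : t ≤ Q)
    (htriv : S * τ ≤ A * B) (hI : S * τ * t ≤ I)
    (h : I ^ 3 ≤ 343 * (Q * B) ^ 2 * (S * R) ^ 2 ∨ I ≤ 4 * (S * R)) :
    S * τ ^ 3 * t ^ 3 ≤ 343 * (Q ^ 2 * R ^ 2 * B ^ 2) := by
  rcases hS.eq_or_lt with rfl | hS
  · simp only [zero_mul]; positivity
  rcases h with h | h
  · have h1 : (S * τ * t) ^ 3 ≤ I ^ 3 := by gcongr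
    refine le_of_mul_le_mul_left ?_ (pow_pos hS 2)
    nlinarith
  · have h1 : τ * t ≤ 4 * R := by
      refine le_of_mul_le_mul_left ?_ hS
      nlinarith
    calc S * τ ^ 3 * t ^ 3 = (S * τ) * (τ * t) ^ 2 * t := by ring
      _ ≤ (A * B) * (4 * R) ^ 2 * t := by gcongr
      _ ≤ (Q * B) * (4 * R) ^ 2 * Q := by gcongr
      _ = 16 * (Q ^ 2 * R ^ 2 * (B * 1)) := by ring
      _ ≤ 343 * (Q ^ 2 * R ^ 2 * (B * B)) := by gcongr; norm_num
      _ = _ := by ring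

/-- The number of representations `x = q * r`. -/
theorem card_inter_smul_inv {Q R : Finset ℝ} (hQ : 0 ∉ Q) (hR : 0 ∉ R) (x : ℝ) :
    (Q ∩ x • R⁻¹).card = ((Q ×ˢ R).filter fun p => p.1 * p.2 = x).card := by
  refine Finset.card_nbij' (fun q => (q, x * q⁻¹)) Prod.fst ?_ ?_ (fun _ _ => rfl) ?_
  · intro q hq
    simp only [Finset.coe_inter, Set.mem_inter_iff, Finset.mem_coe, Finset.mem_smul_finset,
      Finset.mem_inv, smul_eq_mul] at hq
    obtain ⟨hq, _, ⟨r, hr, rfl⟩, rfl⟩ := hq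
    have hr0 : r ≠ 0 := fun h => hR (h ▸ hr)
    have hx0 : x ≠ 0 := by
      rintro rfl
      simp [hQ] at hq
    simp only [Finset.coe_filter, Finset.mem_product, Set.mem_ofPred_eq]
    refine ⟨⟨hq, ?_⟩, ?_⟩
    · convert hr using 1
      field_simp
    · field_simp
  · rintro ⟨q, r⟩ h
    simp only [Finset.coe_filter, Finset.mem_product, Set.mem_ofPred_eq] at h
    obtain ⟨⟨hq, hr⟩, rfl⟩ := h
    have hr0 : r ≠ 0 := fun h => hR (h ▸ hr)
    simp only [Finset.coe_inter, Set.mem_inter_iff, Finset.mem_coe, Finset.mem_smul_finset,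
      Finset.mem_inv, smul_eq_mul]
    exact ⟨hq, r⁻¹, ⟨r, hr, rfl⟩, by field_simp⟩
  · rintro ⟨q, r⟩ h
    simp only [Finset.coe_filter, Finset.mem_product, Set.mem_ofPred_eq] at h
    obtain ⟨⟨hq, hr⟩, rfl⟩ := h
    have hq0 : q ≠ 0 := fun h => hQ (h ▸ hq)
    simp only [Prod.mk.injEq, true_and]
    field_simp

/-- The number of representations `x = q + r`. -/
theorem card_inter_singleton_sub (Q R : Finset ℝ) (x : ℝ) :
    (Q ∩ ({x} - R)).card = ((Q ×ˢ R).filter fun p => p.1 + p.2 = x).card := by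
  refine Finset.card_nbij' (fun q => (q, x - q)) Prod.fst ?_ ?_ (fun _ _ => rfl) ?_
  · intro q hq
    simp only [Finset.coe_inter, Set.mem_inter_iff, Finset.mem_coe, Finset.mem_sub,
      Finset.mem_singleton, exists_eq_left] at hq
    obtain ⟨hq, r, hr, rfl⟩ := hq
    simp [hq, hr]
  · rintro ⟨q, r⟩ h
    simp only [Finset.coe_filter, Finset.mem_product, Set.mem_ofPred_eq] at h
    obtain ⟨⟨hq, hr⟩, rfl⟩ := h
    simp only [Finset.coe_inter, Set.mem_inter_iff, Finset.mem_coe, Finset.mem_sub,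
      Finset.mem_singleton, exists_eq_left]
    exact ⟨hq, r, hr, by ring⟩
  · rintro ⟨q, r⟩ h
    simp only [Finset.coe_filter, Finset.mem_product, Set.mem_ofPred_eq] at h
    obtain ⟨⟨hq, hr⟩, rfl⟩ := h
    simp

theorem card_filter_product_comm (f : ℝ → ℝ → ℝ) (hf : ∀ a b, f a b = f b a)
    (Q R : Finset ℝ) (x : ℝ) :
    ((Q ×ˢ R).filter fun p => f p.1 p.2 = x).card =
      ((R ×ˢ Q).filter fun p => f p.1 p.2 = x).card := by
  refine Finset.card_nbij' Prod.swap Prod.swap ?_ ?_ (fun _ _ => rfl) (fun _ _ => rfl) <;>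
  · rintro ⟨a, b⟩ h
    simp only [Finset.coe_filter, Finset.mem_product, Set.mem_ofPred_eq, Prod.swap] at h ⊢
    exact ⟨h.1.symm, by rw [hf]; exact h.2⟩

theorem card_inter_vadd (A B : Finset ℝ) (s : ℝ) :
    (A ∩ (s +ᵥ B)).card = (B.filter fun b => s + b ∈ A).card := by
  rw [← Finset.card_image_of_injective (B.filter fun b => s + b ∈ A) (add_right_injective s)]
  congr 1
  ext x
  simp only [Finset.mem_inter, Finset.mem_vadd_finset, vadd_eq_add, Finset.mem_image,
    Finset.mem_filter]
  aesop

theorem card_inter_smul (A B : Finset ℝ) {s : ℝ} (hs : s ≠ 0) :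
    (A ∩ s • B).card = (B.filter fun b => s * b ∈ A).card := by
  rw [← Finset.card_image_of_injective (B.filter fun b => s * b ∈ A) (mul_right_injective₀ hs)]
  congr 1
  ext x
  simp only [Finset.mem_inter, Finset.mem_smul_finset, smul_eq_mul, Finset.mem_image,
    Finset.mem_filter]
  aesop

/-- Double counting: if each `s ∈ S` has at least `τ` pairs `b` with `g s b ∈ A`, and each
element of `A` has at least `t` representations, then there are many quadruples. -/
theorem mul_le_card_quadruples {S A B Q R : Finset ℝ} {τ t : ℝ} (ht : 0 ≤ t)
    (f g : ℝ → ℝ → ℝ)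
    (hS : ∀ s ∈ S, τ ≤ ((B.filter fun b => g s b ∈ A).card : ℝ))
    (hA : ∀ a ∈ A, t ≤ (((Q ×ˢ R).filter fun p => f p.1 p.2 = a).card : ℝ)) :
    S.card * τ * t ≤
      (((S ×ˢ B) ×ˢ (Q ×ˢ R)).filter fun p => f p.2.1 p.2.2 = g p.1.1 p.1.2).card := by
  rw [Finset.card_filter, Finset.sum_product, Finset.sum_product]
  push_cast
  rw [mul_assoc, ← nsmul_eq_mul]
  refine Finset.card_nsmul_le_sum _ _ _ fun s hs => ?_
  calc τ * t ≤ ((B.filter fun b => g s b ∈ A).card : ℝ) * t := by gcongr; exact hS s hs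
    _ ≤ ∑ b ∈ B.filter fun b => g s b ∈ A, ∑ p ∈ Q ×ˢ R,
          (if f p.1 p.2 = g s b then (1 : ℝ) else 0) := by
        rw [← nsmul_eq_mul]
        refine Finset.card_nsmul_le_sum _ _ _ fun b hb => ?_
        refine (hA _ (Finset.mem_filter.1 hb).2).trans (le_of_eq ?_)
        rw [Finset.card_filter]
        push_cast
        rfl
    _ ≤ _ := by
        refine Finset.sum_le_sum_of_subset_of_nonneg (Finset.filter_subset _ _)
          fun b _ _ => Finset.sum_nonneg fun p _ => ?_
        split_ifs <;> norm_num

/-- Each of the `|A| |B|` pairs belongs to at most one `s`. -/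
theorem card_mul_le_card_mul_card {S A B : Finset ℝ} {τ : ℝ} (g : ℝ → ℝ → ℝ)
    (hg : ∀ b ∈ B, ∀ s s', g s b = g s' b → s = s')
    (hS : ∀ s ∈ S, τ ≤ ((B.filter fun b => g s b ∈ A).card : ℝ)) :
    S.card * τ ≤ (A.card : ℝ) * B.card := by
  calc S.card * τ ≤ ∑ s ∈ S, ((B.filter fun b => g s b ∈ A).card : ℝ) := by
        rw [← nsmul_eq_mul]
        exact Finset.card_nsmul_le_sum _ _ _ hS
    _ = ((S.sigma fun s => B.filter fun b => g s b ∈ A).card : ℝ) := by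
        rw [Finset.card_sigma]; push_cast; rfl
    _ ≤ ((A ×ˢ B).card : ℝ) := by
        norm_cast
        refine Finset.card_le_card_of_injOn (fun p => (g p.1 p.2, p.2)) ?_ ?_
        · rintro ⟨s, b⟩ h
          simp only [Finset.coe_sigma, Set.mem_sigma_iff, Finset.mem_coe, Finset.mem_filter] at h
          simp [h.2.1, h.2.2]
        · rintro ⟨s, b⟩ h ⟨s', b'⟩ - he
          simp only [Finset.coe_sigma, Set.mem_sigma_iff, Finset.mem_coe, Finset.mem_filter] at h
          simp only [Prod.mk.injEq] at he
          obtain ⟨he, rfl⟩ := he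
          rw [hg b h.2.1 s s' he]
    _ = _ := by rw [Finset.card_product]; push_cast; rfl

/-- In a representation of `a` the first entry determines the second. -/
theorem le_card_left_of_reps {Q R : Finset ℝ} {t a : ℝ} (f : ℝ → ℝ → ℝ)
    (hf : ∀ q ∈ Q, ∀ r r', f q r = f q r' → r = r')
    (h : t ≤ (((Q ×ˢ R).filter fun p => f p.1 p.2 = a).card : ℝ)) : t ≤ Q.card := by
  refine h.trans ?_
  norm_cast
  refine Finset.card_le_card_of_injOn Prod.fst ?_ ?_
  · rintro ⟨q, r⟩ h
    simp only [Finset.coe_filter, Finset.mem_product, Set.mem_ofPred_eq] at h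
    exact h.1.1
  · rintro ⟨q, r⟩ h ⟨q', r'⟩ h' (rfl : q = q')
    simp only [Finset.coe_filter, Finset.mem_product, Set.mem_ofPred_eq] at h h'
    rw [hf q h.1.1 r r' (h.2.trans h'.2.symm)]

/-- Sums of products: `q r = s + b`. -/
theorem rich_translates_bound {S A B Q R : Finset ℝ} {τ t : ℝ} (hτ : 0 < τ) (ht : 0 < t)
    (hB : B.Nonempty) (hA : A.Nonempty) (hQ : 0 ∉ Q) (hR : 0 ∉ R)
    (hcard : A.card ≤ max Q.card R.card)
    (hrep : ∀ a ∈ A, t ≤ (((Q ×ˢ R).filter fun p => p.1 * p.2 = a).card : ℝ))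
    (hS : ∀ s ∈ S, τ ≤ ((B.filter fun b => s + b ∈ A).card : ℝ)) :
    S.card * τ ^ 3 * t ^ 3 ≤ 343 * ((Q.card : ℝ) ^ 2 * (R.card : ℝ) ^ 2 * (B.card : ℝ) ^ 2) := by
  -- The larger of the two sets has to be a side of the grid, so that `|A| ≤ |Q|`.
  wlog hQR : R.card ≤ Q.card generalizing Q R
  · rw [mul_comm ((Q.card : ℝ) ^ 2)]
    refine this hR hQ (by rwa [max_comm]) (fun a ha => ?_) (by omega)
    rw [card_filter_product_comm (fun a b => a * b) mul_comm]
    exact hrep a ha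
  rw [max_eq_left hQR] at hcard
  obtain ⟨a, ha⟩ := hA
  have hI := mul_le_card_quadruples ht.le (fun q r => q * r) (fun s b => s + b) hS hrep
  -- The quadruple is the incidence of `(q, b)` with `y = r x - s`; slopes are nonzero because `0 ∉
  -- R`.
  refine rich_card_bound (A := A.card) (I := ((gridIncidences Q B R (-S)).card : ℝ))
    (Nat.cast_nonneg _) hτ ht (Nat.cast_nonneg _) (Nat.cast_nonneg _)
    (by exact_mod_cast hB.card_pos) (by exact_mod_cast hcard)
    (le_card_left_of_reps (fun q r => q * r)
      (fun q hq r r' h => mul_left_cancel₀ (fun h => hQ (h ▸ hq)) h) (hrep a ha))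
    (card_mul_le_card_mul_card (fun s b => s + b) (fun b _ s s' h => add_right_cancel h) hS)
    (hI.trans ?_) ?_
  · norm_cast
    refine Finset.card_le_card_of_injOn (fun p => (p.2.1, (p.2.2, -p.1.1))) ?_ ?_
    · rintro ⟨⟨s, b⟩, ⟨q, r⟩⟩ h
      simp only [Finset.coe_filter, Finset.mem_product, Set.mem_ofPred_eq] at h
      simp only [gridIncidences, Finset.coe_filter, Finset.mem_product, Set.mem_ofPred_eq,
        Finset.mem_neg, neg_inj, exists_eq_right]
      refine ⟨⟨h.1.2.1, h.1.2.2, h.1.1.1⟩, ?_⟩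
      have : r * q + -s = b := by linarith [h.2]
      rw [this]
      exact h.1.1.2
    · rintro ⟨⟨s, b⟩, ⟨q, r⟩⟩ h ⟨⟨s', b'⟩, ⟨q', r'⟩⟩ h' he
      simp only [Finset.coe_filter, Set.mem_ofPred_eq] at h h'
      simp only [Prod.mk.injEq, neg_inj] at he
      obtain ⟨rfl, rfl, rfl⟩ := he
      have : b = b' := by linarith [h.2, h'.2]
      rw [this]
  · have := card_gridIncidences_dichotomy Q B (-S) hR
    rwa [Finset.card_neg, mul_comm (R.card : ℝ)] at this

/-- Products of sums: `q + r = s b`. -/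
theorem rich_dilates_bound {S A B Q R : Finset ℝ} {τ t : ℝ} (hτ : 0 < τ) (ht : 0 < t)
    (hB : B.Nonempty) (hA : A.Nonempty) (hB0 : 0 ∉ B) (hS0 : 0 ∉ S)
    (hcard : A.card ≤ max Q.card R.card)
    (hrep : ∀ a ∈ A, t ≤ (((Q ×ˢ R).filter fun p => p.1 + p.2 = a).card : ℝ))
    (hS : ∀ s ∈ S, τ ≤ ((B.filter fun b => s * b ∈ A).card : ℝ)) :
    S.card * τ ^ 3 * t ^ 3 ≤ 343 * ((Q.card : ℝ) ^ 2 * (R.card : ℝ) ^ 2 * (B.card : ℝ) ^ 2) := by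
  wlog hQR : R.card ≤ Q.card generalizing Q R
  · rw [mul_comm ((Q.card : ℝ) ^ 2)]
    refine this (by rwa [max_comm]) (fun a ha => ?_) (by omega)
    rw [card_filter_product_comm (fun a b => a + b) add_comm]
    exact hrep a ha
  rw [max_eq_left hQR] at hcard
  obtain ⟨a, ha⟩ := hA
  have hI := mul_le_card_quadruples ht.le (fun q r => q + r) (fun s b => s * b) hS hrep
  -- Now `s` is the slope, so it is `0 ∉ S` that excludes horizontal lines.
  refine rich_card_bound (A := A.card) (I := ((gridIncidences B Q S (-R)).card : ℝ))
    (Nat.cast_nonneg _) hτ ht (Nat.cast_nonneg _) (Nat.cast_nonneg _)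
    (by exact_mod_cast hB.card_pos) (by exact_mod_cast hcard)
    (le_card_left_of_reps (fun q r => q + r) (fun q hq r r' h => add_left_cancel h) (hrep a ha))
    (card_mul_le_card_mul_card (fun s b => s * b)
      (fun b hb s s' h => mul_right_cancel₀ (fun h => hB0 (h ▸ hb)) h) hS)
    (hI.trans ?_) ?_
  · norm_cast
    refine Finset.card_le_card_of_injOn (fun p => (p.1.2, (p.1.1, -p.2.2))) ?_ ?_
    · rintro ⟨⟨s, b⟩, ⟨q, r⟩⟩ h
      simp only [Finset.coe_filter, Finset.mem_product, Set.mem_ofPred_eq] at h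
      simp only [gridIncidences, Finset.coe_filter, Finset.mem_product, Set.mem_ofPred_eq,
        Finset.mem_neg, neg_inj, exists_eq_right]
      refine ⟨⟨h.1.1.2, h.1.1.1, h.1.2.2⟩, ?_⟩
      have : s * b + -r = q := by linarith [h.2]
      rw [this]
      exact h.1.2.1
    · rintro ⟨⟨s, b⟩, ⟨q, r⟩⟩ h ⟨⟨s', b'⟩, ⟨q', r'⟩⟩ h' he
      simp only [Finset.coe_filter, Set.mem_ofPred_eq] at h h'
      simp only [Prod.mk.injEq, neg_inj] at he
      obtain ⟨rfl, rfl, rfl⟩ := he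
      have : q = q' := by linarith [h.2, h'.2]
      rw [this]
  · have := card_gridIncidences_dichotomy B Q (-R) hS0
    rwa [Finset.card_neg, mul_comm (B.card : ℝ)] at this

/-! ### Admissible quotients and Szemerédi–Trotter type -/

/-- This makes every admissible quotient at least 1, which gives positivity of the parameter and
handles small `τ` for dilates. -/
theorem card_mul_pow_three_le {A Q R t : ℝ} (ht : 0 < t) (hA : A ≤ max Q R) (hQ : t ≤ Q)
    (hR : t ≤ R) : A * t ^ 3 ≤ Q ^ 2 * R ^ 2 := by
  have hQ0 : 0 < Q := ht.trans_le hQ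
  have hR0 : 0 < R := ht.trans_le hR
  rcases le_max_iff.1 hA with h | h
  · calc A * t ^ 3 = A * t * t ^ 2 := by ring
      _ ≤ Q * Q * R ^ 2 := by gcongr
      _ = _ := by ring
  · calc A * t ^ 3 = A * t * t ^ 2 := by ring
      _ ≤ R * R * Q ^ 2 := by gcongr
      _ = _ := by ring

theorem le_card_right_of_reps {Q R : Finset ℝ} {t a : ℝ} (f : ℝ → ℝ → ℝ)
    (hcomm : ∀ a b, f a b = f b a) (hf : ∀ r ∈ R, ∀ q q', f r q = f r q' → q = q')
    (h : t ≤ (((Q ×ˢ R).filter fun p => f p.1 p.2 = a).card : ℝ)) : t ≤ R.card := by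
  rw [card_filter_product_comm f hcomm] at h
  exact le_card_left_of_reps f hf h

/-- Unfolded description of the elements of `dMulValues A`. -/
theorem exists_of_mem_dMulValues {A : Finset ℝ} {v : ℝ} (hA : A.Nonempty)
    (hv : v ∈ dMulValues A) : ∃ (t : ℝ) (Q R : Finset ℝ), 0 < t ∧ 0 ∉ Q ∧ 0 ∉ R ∧
      (∀ a ∈ A, t ≤ (((Q ×ˢ R).filter fun p => p.1 * p.2 = a).card : ℝ)) ∧
      A.card ≤ max Q.card R.card ∧
      (A.card : ℝ) * t ^ 3 ≤ (Q.card : ℝ) ^ 2 * (R.card : ℝ) ^ 2 ∧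
      v * A.card * t ^ 3 = (Q.card : ℝ) ^ 2 * (R.card : ℝ) ^ 2 := by
  obtain ⟨t, Q, R, ht, -, -, hQ, hR, hsym, hcard, rfl⟩ := hv
  have hrep : ∀ a ∈ A, t ≤ (((Q ×ˢ R).filter fun p => p.1 * p.2 = a).card : ℝ) := by
    intro a ha
    rw [← card_inter_smul_inv hQ hR]
    exact hsym ha
  obtain ⟨a, ha⟩ := hA
  have hA0 : (0 : ℝ) < A.card := by exact_mod_cast Finset.card_pos.2 ⟨a, ha⟩
  refine ⟨t, Q, R, ht, hQ, hR, hrep, hcard, ?_, by field_simp⟩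
  refine card_mul_pow_three_le ht (by exact_mod_cast hcard)
    (le_card_left_of_reps (fun a b => a * b) ?_ (hrep a ha))
    (le_card_right_of_reps (fun a b => a * b) mul_comm ?_ (hrep a ha))
  · exact fun q hq r r' h => mul_left_cancel₀ (fun h => hQ (h ▸ hq)) h
  · exact fun q hq r r' h => mul_left_cancel₀ (fun h => hR (h ▸ hq)) h

/-- Unfolded description of the elements of `dAddValues A`. -/
theorem exists_of_mem_dAddValues {A : Finset ℝ} {v : ℝ} (hA : A.Nonempty)
    (hv : v ∈ dAddValues A) : ∃ (t : ℝ) (Q R : Finset ℝ), 0 < t ∧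
      (∀ a ∈ A, t ≤ (((Q ×ˢ R).filter fun p => p.1 + p.2 = a).card : ℝ)) ∧
      A.card ≤ max Q.card R.card ∧
      (A.card : ℝ) * t ^ 3 ≤ (Q.card : ℝ) ^ 2 * (R.card : ℝ) ^ 2 ∧
      v * A.card * t ^ 3 = (Q.card : ℝ) ^ 2 * (R.card : ℝ) ^ 2 := by
  obtain ⟨t, Q, R, ht, -, -, -, -, hsym, hcard, rfl⟩ := hv
  have hrep : ∀ a ∈ A, t ≤ (((Q ×ˢ R).filter fun p => p.1 + p.2 = a).card : ℝ) := by
    intro a ha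
    rw [← card_inter_singleton_sub]
    exact hsym ha
  obtain ⟨a, ha⟩ := hA
  have hA0 : (0 : ℝ) < A.card := by exact_mod_cast Finset.card_pos.2 ⟨a, ha⟩
  refine ⟨t, Q, R, ht, hrep, hcard, ?_, by field_simp⟩
  refine card_mul_pow_three_le ht (by exact_mod_cast hcard)
    (le_card_left_of_reps (fun a b => a + b) ?_ (hrep a ha))
    (le_card_right_of_reps (fun a b => a + b) add_comm ?_ (hrep a ha))
  · exact fun q _ r r' h => add_left_cancel h
  · exact fun q _ r r' h => add_left_cancel h

theorem one_le_of_mul_eq {v a t w : ℝ} (ha : 0 < a) (ht : 0 < t) (h : a * t ^ 3 ≤ w)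
    (hv : v * a * t ^ 3 = w) : 1 ≤ v := by
  refine le_of_mul_le_mul_right ?_ (mul_pos ha (pow_pos ht 3))
  linarith

/-- Passing to the infimum in a bound that is linear in `v`. -/
theorem le_of_forall_mem_le_sInf {V : Set ℝ} (hV : V.Nonempty) {N C a b τ : ℝ} (hC : 0 < C)
    (ha : 0 < a) (hb : 0 < b) (hτ : 0 < τ) (h : ∀ v ∈ V, N * τ ^ 3 ≤ C * (v * a * b ^ 2)) :
    N ≤ C * sInf V * a * b ^ 2 / τ ^ 3 := by
  have hD : 0 < C * a * b ^ 2 := by positivity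
  have : N * τ ^ 3 / (C * a * b ^ 2) ≤ sInf V := by
    refine le_csInf hV fun v hv => ?_
    rw [div_le_iff₀ hD]
    linarith [h v hv]
  rw [div_le_iff₀ hD] at this
  rw [le_div_iff₀ (pow_pos hτ 3)]
  linarith

/-- The bound for rich translates holds for every admissible triple, hence for the infimum.
Nonemptiness excludes the default `sInf ∅ = 0`. The constant 343 would do; `2744 = 8 · 343` is
shared with the dilates. -/
theorem isSzTAdd_dMul {A : Finset ℝ} (hA : A.Nonempty) (hV : (dMulValues A).Nonempty) :
    IsSzTAdd A (2744 * dMul A) := by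
  have hA0 : (0 : ℝ) < A.card := by exact_mod_cast hA.card_pos
  refine ⟨?_, fun B τ hτ => ?_⟩
  · have : 1 ≤ dMul A := by
      refine le_csInf hV fun v hv => ?_
      obtain ⟨t, Q, R, ht, -, -, -, -, h1, h2⟩ := exists_of_mem_dMulValues hA hv
      exact one_le_of_mul_eq hA0 ht h1 h2
    positivity
  rcases B.eq_empty_or_nonempty with rfl | hB
  · simp
  have hB0 : (0 : ℝ) < B.card := by exact_mod_cast hB.card_pos
  refine le_of_forall_mem_le_sInf hV (by norm_num) hA0 hB0 (by linarith) fun v hv => ?_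
  obtain ⟨t, Q, R, ht, hQ, hR, hrep, hcard, h1, h2⟩ := exists_of_mem_dMulValues hA hv
  have := rich_translates_bound (S := (A - B).filter fun s => τ ≤ ((A ∩ (s +ᵥ B)).card : ℝ))
    (by linarith : 0 < τ) ht hB hA hQ hR hcard hrep fun s hs => by
      rw [← card_inter_vadd]
      exact (Finset.mem_filter.1 hs).2
  rw [← h2] at this
  refine le_of_mul_le_mul_right (this.trans ?_) (pow_pos ht 3)
  have hv : 0 ≤ v * A.card * t ^ 3 * (B.card : ℝ) ^ 2 := by rw [h2]; positivity
  linarith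

theorem card_filter_mul_erase_inv_le (A B : Finset ℝ) (p : ℝ → Prop) [DecidablePred p] :
    (((A * (B.erase 0)⁻¹).filter p).card : ℝ) ≤ A.card * B.card := by
  norm_cast
  refine (Finset.card_filter_le _ _).trans (Finset.card_mul_le.trans ?_)
  refine Nat.mul_le_mul_left _ ?_
  rw [Finset.card_inv]
  exact Finset.card_le_card (Finset.erase_subset _ _)

theorem isSzTMul_dAdd {A : Finset ℝ} (hA : A.Nonempty) (hV : (dAddValues A).Nonempty) :
    IsSzTMul A (2744 * dAdd A) := by
  have hA0 : (0 : ℝ) < A.card := by exact_mod_cast hA.card_pos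
  refine ⟨?_, fun B τ hτ => ?_⟩
  · have : 1 ≤ dAdd A := by
      refine le_csInf hV fun v hv => ?_
      obtain ⟨t, Q, R, ht, -, -, h1, h2⟩ := exists_of_mem_dAddValues hA hv
      exact one_le_of_mul_eq hA0 ht h1 h2
    positivity
  rcases (B.erase 0).eq_empty_or_nonempty with hBe | hB
  · rw [hBe]
    have h0 : 0 ≤ dAdd A := Real.sInf_nonneg fun v hv => by
      obtain ⟨t, Q, R, ht, -, -, h1, h2⟩ := exists_of_mem_dAddValues hA hv
      linarith [one_le_of_mul_eq hA0 ht h1 h2]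
    simp only [Finset.inv_empty, Finset.mul_empty, Finset.filter_empty, Finset.card_empty,
      Nat.cast_zero]
    positivity
  have hBB : ((B.erase 0).card : ℝ) ≤ B.card := by
    exact_mod_cast Finset.card_le_card (Finset.erase_subset _ _)
  have hB1 : (1 : ℝ) ≤ B.card := by
    refine le_trans ?_ hBB
    exact_mod_cast hB.card_pos
  refine le_of_forall_mem_le_sInf hV (by norm_num) hA0 (by linarith) (by linarith) fun v hv => ?_
  obtain ⟨t, Q, R, ht, hrep, hcard, h1, h2⟩ := exists_of_mem_dAddValues hA hv
  have hv1 : 1 ≤ v := one_le_of_mul_eq hA0 ht h1 h2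
  -- Below 2 there are at most `|A| |B|` candidates for `s`, and `τ³ < 8` with `v ≥ 1` suffices.
  rcases lt_or_ge τ 2 with hτ2 | hτ2
  · calc _ ≤ ((A.card : ℝ) * B.card) * 2 ^ 3 := by
          gcongr
          exact card_filter_mul_erase_inv_le A B _
      _ = 8 * (1 * A.card * (B.card * 1)) := by ring
      _ ≤ 2744 * (v * A.card * (B.card * B.card)) := by gcongr; norm_num
      _ = _ := by ring
  set S := (A * (B.erase 0)⁻¹).filter fun s => τ ≤ ((A ∩ s • B).card : ℝ) with hS
  have hcardS : ∀ s ∈ S, s ≠ 0 ∧ τ / 2 ≤ (((B.erase 0).filter fun b => s * b ∈ A).card : ℝ) := by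
    intro s hs
    have hs := (Finset.mem_filter.1 hs).2
    -- The dilate by 0 has at most one element, fewer than `τ ≥ 2`.
    have hs0 : s ≠ 0 := by
      rintro rfl
      have : (A ∩ (0 : ℝ) • B).card ≤ 1 := by
        calc _ ≤ ({0} : Finset ℝ).card := Finset.card_le_card
              (Finset.inter_subset_right.trans (Finset.zero_smul_finset_subset B))
          _ = 1 := rfl
      have : ((A ∩ (0 : ℝ) • B).card : ℝ) ≤ 1 := by exact_mod_cast this
      linarith
    refine ⟨hs0, ?_⟩
    rw [card_inter_smul A B hs0] at hs
    -- Deleting 0 from `B` loses at most one solution, and `τ - 1 ≥ τ / 2`. Halving `τ` costs the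
    -- factor `2³` in `2744 = 8 · 343`.
    have : (B.filter fun b => s * b ∈ A).card ≤
        ((B.erase 0).filter fun b => s * b ∈ A).card + 1 := by
      rw [Finset.filter_erase]
      exact Nat.sub_le_iff_le_add.1 Finset.pred_card_le_card_erase
    have : ((B.filter fun b => s * b ∈ A).card : ℝ) ≤
        ((B.erase 0).filter fun b => s * b ∈ A).card + 1 := by exact_mod_cast this
    linarith
  have hrich := rich_dilates_bound (S := S) (by linarith : 0 < τ / 2) ht hB hA
    (Finset.notMem_erase 0 B) (fun h => (hcardS 0 h).1 rfl) hcard hrep fun s hs => (hcardS s hs).2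
  rw [← h2] at hrich
  refine le_of_mul_le_mul_right ?_ (pow_pos ht 3)
  have : v * A.card * t ^ 3 * ((B.erase 0).card : ℝ) ^ 2 ≤
      v * A.card * t ^ 3 * (B.card : ℝ) ^ 2 := by gcongr
  linarith

/-! ### The popular level set -/

/-- A popular level of a bounded function, at the cost of a logarithm. -/
theorem exists_popular_level {A : Finset ℝ} (hA : 2 ≤ A.card) (f : ℝ → ℕ)
    (hf : ∀ a ∈ A, f a ≤ A.card) (hpos : 0 < ∑ a ∈ A, f a) :
    ∃ t : ℕ, 0 < t ∧ ((∑ a ∈ A, f a : ℕ) : ℝ) ≤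
      3 * Real.log A.card * (t * ((A.filter fun a => t ≤ f a).card : ℝ)) := by
  have hsum : ∑ a ∈ A, f a =
      ∑ t ∈ Finset.Icc 1 A.card, (A.filter fun a => t ≤ f a).card := by
    simp only [Finset.card_filter]
    rw [Finset.sum_comm]
    refine Finset.sum_congr rfl fun a ha => ?_
    rw [← Finset.card_filter]
    have : (Finset.Icc 1 A.card).filter (fun t => t ≤ f a) = Finset.Icc 1 (f a) := by
      ext t
      have := hf a ha
      simp only [Finset.mem_filter, Finset.mem_Icc]
      omega
    rw [this, Nat.card_Icc, Nat.add_sub_cancel]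
  have hlog : Real.log 2 ≤ Real.log A.card :=
    Real.log_le_log (by norm_num) (by exact_mod_cast hA)
  have hlog2 := Real.log_two_gt_d9
  -- If every level set has fewer than `σ / (3 t log|A|)` elements, summing over `t` contradicts
  -- `H_n ≤ 1 + log n ≤ 3 log n`.
  by_contra! hcon
  set σ : ℝ := ((∑ a ∈ A, f a : ℕ) : ℝ) with hσ
  have hσ0 : 0 < σ := Nat.cast_pos.2 hpos
  have hL : 0 < 3 * Real.log A.card := by linarith
  have h1 : σ * (3 * Real.log A.card) < σ * (harmonic A.card : ℝ) := by
    rw [harmonic_eq_sum_Icc]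
    conv_lhs => rw [hσ, hsum]
    push_cast
    rw [Finset.sum_mul, Finset.mul_sum]
    refine Finset.sum_lt_sum_of_nonempty ⟨1, Finset.mem_Icc.2 ⟨le_rfl, by omega⟩⟩ fun t ht => ?_
    have ht : 0 < t := (Finset.mem_Icc.1 ht).1
    have ht' : (0 : ℝ) < t := by exact_mod_cast ht
    rw [← div_eq_mul_inv, lt_div_iff₀ ht']
    linarith [hcon t ht]
  have h2 := harmonic_le_one_add_log A.card
  nlinarith

theorem sum_card_reps (A P B : Finset ℝ) (f : ℝ → ℝ → ℝ) :
    ∑ a ∈ A, ((P ×ˢ B).filter fun p => f p.1 p.2 = a).card =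
      ∑ x ∈ P, (B.filter fun b => f x b ∈ A).card := by
  simp only [Finset.card_filter]
  rw [Finset.sum_comm, Finset.sum_product]
  simp

/-- The term `x = 0` vanishes since `0 ∉ A`, so `P` may be replaced by `P \ {0}`, as admissibility
demands. -/
theorem sigmaMul_eq_sum_reps {A : Finset ℝ} (P : Finset ℝ) (hA : 0 ∉ A) :
    sigmaMul A P = ∑ a ∈ A, ((P.erase 0 ×ˢ A).filter fun p => p.1 * p.2 = a).card := by
  rw [sum_card_reps A (P.erase 0) A (fun a b => a * b), sigmaMul,
    ← Finset.sum_erase (a := 0) P]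
  · exact Finset.sum_congr rfl fun x hx => card_inter_smul A A (Finset.ne_of_mem_erase hx)
  · rw [Finset.card_eq_zero, Finset.eq_empty_iff_forall_notMem]
    intro x hx
    obtain ⟨hxA, hx⟩ := Finset.mem_inter.1 hx
    have := Finset.zero_smul_finset_subset A hx
    rw [Finset.mem_zero] at this
    exact hA (this ▸ hxA)

theorem sigmaAdd_eq_sum_reps (A P : Finset ℝ) :
    sigmaAdd A P = ∑ a ∈ A, ((P ×ˢ A).filter fun p => p.1 + p.2 = a).card := by
  rw [sum_card_reps A P A (fun a b => a + b), sigmaAdd]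
  exact Finset.sum_congr rfl fun x _ => card_inter_vadd A A x

/-- Opposite translations preserve sums; this frees both summands of 0 without affecting
representation counts. -/
theorem card_filter_add_eq_translate (P A : Finset ℝ) (u a : ℝ) :
    (((u +ᵥ P) ×ˢ (-u +ᵥ A)).filter fun p => p.1 + p.2 = a).card =
      ((P ×ˢ A).filter fun p => p.1 + p.2 = a).card := by
  refine Finset.card_nbij' (fun p => (-u + p.1, u + p.2)) (fun p => (u + p.1, -u + p.2))
    ?_ ?_ (fun _ _ => by simp) (fun _ _ => by simp)
  · rintro ⟨x, y⟩ h
    simp only [Finset.coe_filter, Finset.mem_product, Finset.mem_vadd_finset, vadd_eq_add,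
      Set.mem_ofPred_eq] at h ⊢
    obtain ⟨⟨⟨x, hx, rfl⟩, ⟨y, hy, rfl⟩⟩, rfl⟩ := h
    simp only [neg_add_cancel_left, add_neg_cancel_left]
    exact ⟨⟨hx, hy⟩, by ring⟩
  · rintro ⟨x, y⟩ h
    simp only [Finset.coe_filter, Finset.mem_product, Finset.mem_vadd_finset, vadd_eq_add,
      Set.mem_ofPred_eq] at h ⊢
    obtain ⟨⟨hx, hy⟩, rfl⟩ := h
    exact ⟨⟨⟨x, hx, rfl⟩, ⟨y, hy, rfl⟩⟩, by ring⟩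

/-- Cubing `σ ≤ 3 ℓ t a` eliminates `t` from the quotient and produces the exponent 3 of the
logarithm. The second bound needs only one power of `ℓ`, raised to the third by `1 ≤ 2 ℓ`. -/
theorem popular_level_bounds {σ ℓ t a p p' n : ℝ} (hσ : 0 < σ) (hℓ : 1 ≤ 2 * ℓ) (ht : 0 < t)
    (ha : 0 < a) (htp : t ≤ p') (hp : p' ≤ p) (h : σ ≤ 3 * ℓ * (t * a)) :
    p' ^ 2 * n ^ 2 / (a * t ^ 3) ≤ 2744 * ℓ ^ (3 : ℝ) * (p ^ 2 * n ^ 2 * a ^ 2 / σ ^ 3) ∧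
      σ / p ≤ 2744 * ℓ ^ (3 : ℝ) * a := by
  have hℓ0 : 0 < ℓ := by linarith
  have hp' : 0 < p' := ht.trans_le htp
  have hp0 : 0 < p := hp'.trans_le hp
  rw [Real.rpow_ofNat]
  constructor
  · rw [← mul_div_assoc, div_le_div_iff₀ (by positivity) (by positivity)]
    calc p' ^ 2 * n ^ 2 * σ ^ 3 ≤ p ^ 2 * n ^ 2 * (3 * ℓ * (t * a)) ^ 3 := by gcongr
      _ = 27 * (ℓ ^ 3 * (p ^ 2 * n ^ 2 * a ^ 2) * (a * t ^ 3)) := by ring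
      _ ≤ 2744 * (ℓ ^ 3 * (p ^ 2 * n ^ 2 * a ^ 2) * (a * t ^ 3)) := by gcongr; norm_num
      _ = _ := by ring
  · rw [div_le_iff₀ hp0]
    calc σ ≤ 3 * ℓ * (t * a) := h
      _ ≤ 3 * ℓ * (p * a) := by gcongr; exact htp.trans hp
      _ = 3 * (ℓ * a * p) * 1 ^ 2 := by ring
      _ ≤ 3 * (ℓ * a * p) * (2 * ℓ) ^ 2 := by gcongr
      _ = 12 * (ℓ ^ 3 * a * p) := by ring
      _ ≤ 2744 * (ℓ ^ 3 * a * p) := by gcongr; norm_num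
      _ = _ := by ring

theorem one_le_two_mul_log {n : ℕ} (hn : 2 ≤ n) : 1 ≤ 2 * Real.log n := by
  have hlog : Real.log 2 ≤ Real.log n := Real.log_le_log (by norm_num) (by exact_mod_cast hn)
  linarith [Real.log_two_gt_d9]

theorem bddBelow_dMulValues (A : Finset ℝ) : BddBelow (dMulValues A) := by
  refine ⟨0, ?_⟩
  rintro _ ⟨t, Q, R, ht, -, -, -, -, -, -, rfl⟩
  positivity

theorem bddBelow_dAddValues (A : Finset ℝ) : BddBelow (dAddValues A) := by
  refine ⟨0, ?_⟩
  rintro _ ⟨t, Q, R, ht, -, -, -, -, -, -, rfl⟩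
  positivity

/-- The witness for `d_*(A')` is `(t, P \ {0}, A)`; its size condition is just `A' ⊆ A`. -/
theorem exists_subset_isSzTAdd {A P : Finset ℝ} (hcard : 2 ≤ A.card) (h0 : 0 ∉ A)
    (hpos : 0 < sigmaMul A P) :
    ∃ A' : Finset ℝ, A' ⊆ A ∧ IsSzTAdd A' (2744 * dMul A') ∧
      dMul A' ≤ 2744 * Real.log (A.card : ℝ) ^ (3 : ℝ) *
        ((P.card : ℝ) ^ 2 * (A.card : ℝ) ^ 2 * (A'.card : ℝ) ^ 2 / (sigmaMul A P : ℝ) ^ 3) ∧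
      (sigmaMul A P : ℝ) / (P.card : ℝ) ≤
        2744 * Real.log (A.card : ℝ) ^ (3 : ℝ) * (A'.card : ℝ) := by
  have hσ := sigmaMul_eq_sum_reps P h0
  have hcancel : ∀ a ∈ A, ∀ x y : ℝ, a * x = a * y → x = y :=
    fun a ha x y h => mul_left_cancel₀ (fun h => h0 (h ▸ ha)) h
  have hcancel' : ∀ a ∈ P.erase 0, ∀ x y : ℝ, a * x = a * y → x = y :=
    fun a ha x y h => mul_left_cancel₀ (Finset.ne_of_mem_erase ha) h
  obtain ⟨t, ht, hlevel⟩ := exists_popular_level hcard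
    (fun a => ((P.erase 0 ×ˢ A).filter fun p => p.1 * p.2 = a).card)
    (fun a _ => by
      exact_mod_cast le_card_right_of_reps (fun a b => a * b) mul_comm hcancel
        (le_refl (((P.erase 0 ×ˢ A).filter fun p => p.1 * p.2 = a).card : ℝ)))
    (hσ ▸ hpos)
  rw [← hσ] at hlevel
  set A' := A.filter fun a => t ≤ ((P.erase 0 ×ˢ A).filter fun p => p.1 * p.2 = a).card
    with hA'
  have hsub : A' ⊆ A := Finset.filter_subset _ _
  have hσ0 : (0 : ℝ) < sigmaMul A P := by exact_mod_cast hpos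
  have ht0 : (0 : ℝ) < t := by exact_mod_cast ht
  have hne : A'.Nonempty := by
    rw [Finset.nonempty_iff_ne_empty]
    intro h
    rw [h] at hlevel
    simp only [Finset.card_empty, Nat.cast_zero, mul_zero] at hlevel
    linarith
  have hrep : ∀ a ∈ A', (t : ℝ) ≤
      (((P.erase 0 ×ˢ A).filter fun p => p.1 * p.2 = a).card : ℝ) := fun a ha => by
    exact_mod_cast (Finset.mem_filter.1 ha).2
  obtain ⟨a, ha⟩ := hne
  have htP := le_card_left_of_reps (fun a b => a * b) hcancel' (hrep a ha)
  have hmem : ((P.erase 0).card : ℝ) ^ 2 * (A.card : ℝ) ^ 2 / ((A'.card : ℝ) * (t : ℝ) ^ 3) ∈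
      dMulValues A' := by
    refine ⟨t, P.erase 0, A, ht0, Finset.card_pos.1 (by exact_mod_cast ht0.trans_le htP),
      ⟨a, hsub ha⟩, Finset.notMem_erase 0 P, h0, fun b hb => ?_,
      (Finset.card_le_card hsub).trans (le_max_right _ _), rfl⟩
    have := hrep b hb
    rwa [← card_inter_smul_inv (Finset.notMem_erase 0 P) h0] at this
  obtain ⟨h1, h2⟩ := popular_level_bounds (p := P.card) (n := A.card) hσ0
    (one_le_two_mul_log hcard) ht0
    (by exact_mod_cast Finset.card_pos.2 ⟨a, ha⟩ : (0 : ℝ) < A'.card) htP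
    (by exact_mod_cast Finset.card_le_card (Finset.erase_subset _ _)) hlevel
  refine ⟨A', hsub, isSzTAdd_dMul ⟨a, ha⟩ ⟨_, hmem⟩, ?_, h2⟩
  exact (csInf_le (bddBelow_dMulValues A') hmem).trans h1

theorem exists_subset_isSzTMul {A P : Finset ℝ} (hcard : 2 ≤ A.card)
    (hpos : 0 < sigmaAdd A P) :
    ∃ A' : Finset ℝ, A' ⊆ A ∧ IsSzTMul A' (2744 * dAdd A') ∧
      dAdd A' ≤ 2744 * Real.log (A.card : ℝ) ^ (3 : ℝ) *
        ((P.card : ℝ) ^ 2 * (A.card : ℝ) ^ 2 * (A'.card : ℝ) ^ 2 / (sigmaAdd A P : ℝ) ^ 3) ∧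
      (sigmaAdd A P : ℝ) / (P.card : ℝ) ≤
        2744 * Real.log (A.card : ℝ) ^ (3 : ℝ) * (A'.card : ℝ) := by
  have hσ := sigmaAdd_eq_sum_reps A P
  obtain ⟨t, ht, hlevel⟩ := exists_popular_level hcard
    (fun a => ((P ×ˢ A).filter fun p => p.1 + p.2 = a).card)
    (fun a _ => by
      exact_mod_cast le_card_right_of_reps (fun a b => a + b) add_comm
        (fun _ _ _ _ h => add_left_cancel h)
        (le_refl (((P ×ˢ A).filter fun p => p.1 + p.2 = a).card : ℝ)))
    (hσ ▸ hpos)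
  rw [← hσ] at hlevel
  set A' := A.filter fun a => t ≤ ((P ×ˢ A).filter fun p => p.1 + p.2 = a).card
    with hA'
  have hsub : A' ⊆ A := Finset.filter_subset _ _
  have hσ0 : (0 : ℝ) < sigmaAdd A P := by exact_mod_cast hpos
  have ht0 : (0 : ℝ) < t := by exact_mod_cast ht
  have hne : A'.Nonempty := by
    rw [Finset.nonempty_iff_ne_empty]
    intro h
    rw [h] at hlevel
    simp only [Finset.card_empty, Nat.cast_zero, mul_zero] at hlevel
    linarith
  have hrep : ∀ a ∈ A', (t : ℝ) ≤
      (((P ×ˢ A).filter fun p => p.1 + p.2 = a).card : ℝ) := fun a ha => by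
    exact_mod_cast (Finset.mem_filter.1 ha).2
  obtain ⟨a, ha⟩ := hne
  have htP := le_card_left_of_reps (fun a b => a + b)
    (fun _ _ _ _ h => add_left_cancel h) (hrep a ha)
  -- Translating `P` and `A` in opposite directions keeps `0` out of both sets.
  obtain ⟨u, hu⟩ := Infinite.exists_notMem_finset (-P ∪ A)
  rw [Finset.mem_union, not_or, Finset.mem_neg'] at hu
  have hmem : (P.card : ℝ) ^ 2 * (A.card : ℝ) ^ 2 / ((A'.card : ℝ) * (t : ℝ) ^ 3) ∈
      dAddValues A' := by
    refine ⟨t, u +ᵥ P, -u +ᵥ A, ht0, ?_, ?_, ?_, ?_, fun b hb => ?_, ?_, ?_⟩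
    · rw [Finset.vadd_finset_nonempty]
      exact Finset.card_pos.1 (by exact_mod_cast ht0.trans_le htP)
    · rw [Finset.vadd_finset_nonempty]
      exact ⟨a, hsub ha⟩
    · rw [Finset.mem_vadd_finset]
      rintro ⟨x, hx, h⟩
      exact hu.1 (by rwa [← eq_neg_of_add_eq_zero_right h])
    · rw [Finset.mem_vadd_finset]
      rintro ⟨x, hx, h⟩
      have : x = u := by rw [vadd_eq_add] at h; linarith
      exact hu.2 (this ▸ hx)
    · have := hrep b hb
      rwa [← card_filter_add_eq_translate P A u,
        ← card_inter_singleton_sub] at this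
    · rw [Finset.card_vadd_finset, Finset.card_vadd_finset]
      exact (Finset.card_le_card hsub).trans (le_max_right _ _)
    · rw [Finset.card_vadd_finset, Finset.card_vadd_finset]
  obtain ⟨h1, h2⟩ := popular_level_bounds (p := P.card) (n := A.card) hσ0
    (one_le_two_mul_log hcard) ht0
    (by exact_mod_cast Finset.card_pos.2 ⟨a, ha⟩ : (0 : ℝ) < A'.card) htP le_rfl hlevel
  refine ⟨A', hsub, isSzTMul_dAdd ⟨a, ha⟩ ⟨_, hmem⟩, ?_, h2⟩
  exact (csInf_le (bddBelow_dAddValues A') hmem).trans h1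

end SumProduct

theorem lemma19 :
    ∃ C c : ℝ, 0 < C ∧ 0 < c ∧ ∀ A P : Finset ℝ, 2 ≤ A.card →
      (0 ∉ A → 0 < SumProduct.sigmaMul A P →
        ∃ A' : Finset ℝ, A' ⊆ A ∧
          SumProduct.IsSzTAdd A' (C * SumProduct.dMul A') ∧
          SumProduct.dMul A' ≤ C * Real.log (A.card : ℝ) ^ c *
            ((P.card : ℝ) ^ 2 * (A.card : ℝ) ^ 2 * (A'.card : ℝ) ^ 2 /
              (SumProduct.sigmaMul A P : ℝ) ^ 3) ∧
          (SumProduct.sigmaMul A P : ℝ) / (P.card : ℝ) ≤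
            C * Real.log (A.card : ℝ) ^ c * (A'.card : ℝ)) ∧
      (0 < SumProduct.sigmaAdd A P →
        ∃ A'' : Finset ℝ, A'' ⊆ A ∧
          SumProduct.IsSzTMul A'' (C * SumProduct.dAdd A'') ∧
          SumProduct.dAdd A'' ≤ C * Real.log (A.card : ℝ) ^ c *
            ((P.card : ℝ) ^ 2 * (A.card : ℝ) ^ 2 * (A''.card : ℝ) ^ 2 /
              (SumProduct.sigmaAdd A P : ℝ) ^ 3) ∧
          (SumProduct.sigmaAdd A P : ℝ) / (P.card : ℝ) ≤
            C * Real.log (A.card : ℝ) ^ c * (A''.card : ℝ)) := by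
  exact ⟨2744, 3, by norm_num, by norm_num, fun A P hcard =>
    ⟨fun h0 hpos => SumProduct.exists_subset_isSzTAdd hcard h0 hpos,
      fun hpos => SumProduct.exists_subset_isSzTMul hcard hpos⟩⟩
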